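/- Setting. Let $d\ge 1$, let $D\subset\mathbb R^d$ be open, convex and bounded, let $c\in\mathbb R^d$, and put $\mathrm{val}=\inf_{x\in D}c^Tx$. For a matrix $M$ write $\|v\|_M=\sqrt{v^TMv}$. Let $f:D\to\mathbb R$ be twice continuously differentiable with gradient $g(x)$ and positive definite Hessian $H(x)$, and write $\|v\|_x=\|v\|_{H(x)}$. Assume that $f$ is a self-concordant barrier for $D$: (i) for every $x\in D$ the open ball $\{y:\|y-x\|_x<1\}$ is contained in $D$, and for every $y$ in it and every $v\ne0$, $$1-\|y-x\|_x\le \frac{\|v\|_y}{\|v\|_x}\le\frac1{1-\|y-x\|_x};$$ (ii) $f(x)\to\infty$ as $x$ tends to any boundary point of $D$; (iii) the complexity $\vartheta_f=\sup_{x\in D}\|H(x)^{-1}g(x)\|_x^2$ is finite. For $\eta>0$ let $f_\eta(x)=\eta c^Tx+f(x)$, with Newton step $n_\eta(x)=-H(x)^{-1}(\eta c+g(x))$. Assume that we are given $\eta_0>0$ and an initial point $z_0\in D$ with $\|n_{\eta_0}(z_0)\|_{z_0}\le 1/4$. Algorithm. Let $\epsilon>0$ and $C\ge1$. Start with $x=z_0$,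 $\eta=\eta_0$, and repeat the following round. Obtain one approximate gradient $\tilde g$ and one approximate Hessian $\tilde H$ of $f$ at the current point $x$, and let $\tilde d=-\tilde H^{-1}(\eta c+\tilde g)$. If $\|\tilde d\|_{\tilde H}\ge\frac1{32}$, replace $x$ by $x+\frac1{4C}\tilde d$; otherwise, if $\eta\ge 2\vartheta_f/\epsilon$, stop and return $x'=x$; otherwise replace $\eta$ by $\bigl(1+\frac1{8\sqrt{\vartheta_f}}\bigr)\eta$. **Theorem (IPM based on approximate Newton steps).** There is an absolute constant $K>0$ such that, for all data as above, if in every round the approximations (which are otherwise arbitrary, and may differ between rounds at the same point) satisfy $$\|\tilde g-g(x)\|_{H(x)^{-1}}\le\frac1{128\sqrt C}\qquad\text{and}\qquad \tilde H\preceq H(x)\preceq C\,\tilde H,$$ then the algorithm stops after finitely many rounds $N$, all of its iterates lie in $D$, and the returned point $x'\in D$ satisfies $c^Tx'\le\mathrm{val}+\epsilon$. The number $N$ of approximate gradients, and of approximate Hessians, that it uses satisfies $$N\le K\,C^2\sqrt{\vartheta_f}\,\log\Bigl(2+\frac{\vartheta_f}{\eta_0\epsilon}\Bigr),$$ and hence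 $N\le K\,C^2\sqrt{\vartheta_f}\,\log(1/\epsilon)$ whenever $\epsilon\le\frac12$ and $\vartheta_f/\eta_0\le1/\epsilon$. In particular, if $C\le\mathrm{polylog}(n)$ for a size parameter $n$, then the required precision of the gradients is $1/\mathrm{polylog}(n)$ and $N$ is $O(\sqrt{\vartheta_f}\log(1/\epsilon))$ up to a factor $\mathrm{polylog}(n)$ for such $\epsilon$. -/

import Mathlib

open Filter Topology Matrix

namespace ApproxIPM

/-! Vectors of `ℝ^d` are functions `Fin d → ℝ`; the inner product is the standard one `⬝ᵥ`.
The norm carried by this type is only used for its topology, its bounded sets and its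
derivatives, which are the usual ones of `ℝ^d`. -/

/-- The norm `‖v‖_M = √(vᵀ M v)`. -/
noncomputable def matNorm {d : ℕ} (M : Matrix (Fin d) (Fin d) ℝ) (v : Fin d → ℝ) : ℝ :=
  √(v ⬝ᵥ (M *ᵥ v))

/-- The Loewner order `A ⪯ B`. -/
def LoewnerLE {d : ℕ} (A B : Matrix (Fin d) (Fin d) ℝ) : Prop :=
  (B - A).PosSemidef

/-- The gradient of `f` at `x` for the standard inner product: the vector of partial
derivatives. -/
noncomputable def grad {d : ℕ} (f : (Fin d → ℝ) → ℝ) (x : Fin d → ℝ) : Fin d → ℝ :=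
  fun i => fderiv ℝ f x (Pi.single i 1)

/-- The Hessian of `f` at `x`: the matrix of second partial derivatives. -/
noncomputable def hess {d : ℕ} (f : (Fin d → ℝ) → ℝ) (x : Fin d → ℝ) :
    Matrix (Fin d) (Fin d) ℝ :=
  Matrix.of fun i j => fderiv ℝ (fderiv ℝ f) x (Pi.single i 1) (Pi.single j 1)

/-- The local norm `‖v‖_x = √(vᵀ H(x) v)` of `f`. -/
noncomputable def localNorm {d : ℕ} (f : (Fin d → ℝ) → ℝ) (x v : Fin d → ℝ) : ℝ :=
  matNorm (hess f x) v

/-- The (exact) Newton step `n(x) = -H(x)⁻¹ g(x)`. -/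
noncomputable def newtonStep {d : ℕ} (f : (Fin d → ℝ) → ℝ) (x : Fin d → ℝ) : Fin d → ℝ :=
  -((hess f x)⁻¹ *ᵥ grad f x)

/-- Strongly nondegenerate self-concordance of `f` on the open set `D`; the values of `f`
outside `D` play no role. -/
structure IsSelfConcordant {d : ℕ} (D : Set (Fin d → ℝ)) (f : (Fin d → ℝ) → ℝ) : Prop where
  contDiffOn : ContDiffOn ℝ 2 f D
  posDef : ∀ x ∈ D, (hess f x).PosDef
  ball_subset : ∀ x ∈ D, {y | localNorm f x (y - x) < 1} ⊆ D
  ratio : ∀ x ∈ D, ∀ y, localNorm f x (y - x) < 1 → ∀ v, v ≠ 0 →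
    1 - localNorm f x (y - x) ≤ localNorm f y v / localNorm f x v ∧
      localNorm f y v / localNorm f x v ≤ 1 / (1 - localNorm f x (y - x))

/-- The numbers `‖g_x(x)‖_x²`, `x ∈ D`, where `g_x(x) = H(x)⁻¹ g(x)`. -/
def localGradSq {d : ℕ} (D : Set (Fin d → ℝ)) (f : (Fin d → ℝ) → ℝ) : Set ℝ :=
  (fun x => localNorm f x ((hess f x)⁻¹ *ᵥ grad f x) ^ 2) '' D

/-- The complexity `ϑ_f = sup_{x ∈ D} ‖g_x(x)‖_x²`. -/
noncomputable def complexity {d : ℕ} (D : Set (Fin d → ℝ)) (f : (Fin d → ℝ) → ℝ) : ℝ :=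
  sSup (localGradSq D f)

/-- `f` is a self-concordant barrier for `D`: it is self-concordant, tends to `∞` at the
boundary of `D`, and its complexity is finite. -/
structure IsSelfConcordantBarrier {d : ℕ} (D : Set (Fin d → ℝ)) (f : (Fin d → ℝ) → ℝ) :
    Prop where
  selfConcordant : IsSelfConcordant D f
  tendsto_boundary : ∀ p ∈ frontier D, Tendsto f (𝓝[D] p) atTop
  complexity_finite : BddAbove (localGradSq D f)

/-- The penalized objective `f_η(x) = η cᵀx + f(x)`. -/
def penalized {d : ℕ} (c : Fin d → ℝ) (f : (Fin d → ℝ) → ℝ) (η : ℝ) (x : Fin d → ℝ) : ℝ :=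
  η * (c ⬝ᵥ x) + f x

/-- The state of the path-following method: current iterate, current path parameter, and
whether the method has halted (and returned the current iterate). -/
structure IPMState (d : ℕ) where
  point : Fin d → ℝ
  eta : ℝ
  halted : Bool

/-- One round of the approximate short-step method, given one approximate gradient `gt` and one
approximate Hessian `Q` of the barrier at the current iterate. With the approximate Newton step
`dt = -Q⁻¹ (η c + gt)` of `f_η`:
* if `‖dt‖_Q ≥ 1/32`, move to `x + dt / (4 C)`;
* otherwise, if `η ≥ 2 ϑ / ε`, halt and return `x`;
* otherwise, increase `η` to `(1 + 1 / (8 √ϑ)) η`. -/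
noncomputable def ipmStep {d : ℕ} (c : Fin d → ℝ) (ϑ ε C : ℝ) (gt : Fin d → ℝ)
    (Q : Matrix (Fin d) (Fin d) ℝ) (s : IPMState d) : IPMState d :=
  let dt : Fin d → ℝ := -(Q⁻¹ *ᵥ (s.eta • c + gt))
  if s.halted then s
  else if 1 / 32 ≤ matNorm Q dt then { s with point := s.point + (1 / (4 * C)) • dt }
  else if 2 * ϑ ≤ ε * s.eta then { s with halted := true }
  else { s with eta := (1 + 1 / (8 * √ϑ)) * s.eta }

/-- The state of the method after `k` rounds, started at `z₀` with path parameter `η₀`. In its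
round number `k` it asks for one approximate gradient and one approximate Hessian at its current
iterate `x`, and receives `gt k x` and `Ht k x`. The answers may depend on the round, so
a repeated question may be answered differently. -/
noncomputable def ipmRun {d : ℕ} (c : Fin d → ℝ) (ϑ ε C : ℝ)
    (gt : ℕ → (Fin d → ℝ) → (Fin d → ℝ))
    (Ht : ℕ → (Fin d → ℝ) → Matrix (Fin d) (Fin d) ℝ) (η₀ : ℝ) (z₀ : Fin d → ℝ) :
    ℕ → IPMState d
  | 0 => ⟨z₀, η₀, false⟩
  | k + 1 =>
    let s := ipmRun c ϑ ε C gt Ht η₀ z₀ k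
    ipmStep c ϑ ε C (gt k s.point) (Ht k s.point) s

end ApproxIPM

/-! The potential is the gap between `f_η(x)` and the minimum of `f_η`. A Newton decrement of at
most 1/4, as at the start, bounds the gap by 1/12 (`IsSelfConcordant.penalized_ge`), and so small a
gap keeps the decrement below 1. Under that bound the damping `1/(4C)` keeps a step inside the Dikin
ellipsoid despite the Hessian error, and a long approximate step lowers `f_η` by `1/(16384 C)`
(`IsApprox.step`). Hence only O(C) moves occur for each value of `η`.

A short approximate step certifies an exact decrement of at most 5/128 (`IsApprox.decrement_le`).
The increase of `η` then leaves it at most 1/4 (`IsSelfConcordantBarrier.decrement_increase_le`),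
and the cycle restarts. Since `η` grows geometrically, there are O(√ϑ log) increases
(`Invariant.updates_le`).

At halting, `x` is close to the minimizer `z` of `f_η`, where `ηc = -g(z)`. The barrier inequality
at `z` and Cauchy–Schwarz each cost `ϑ/η`, so the error is at most `2ϑ/η ≤ ε`
(`IsSelfConcordantBarrier.dotProduct_le`). The self-concordance estimates all come from integrating
the ratio condition along segments. -/

namespace ApproxIPM

/-! ### Quadratic norms -/

section MatNorm

variable {d : ℕ} {M A B : Matrix (Fin d) (Fin d) ℝ}

lemma matNorm_nonneg (M : Matrix (Fin d) (Fin d) ℝ) (v : Fin d → ℝ) : 0 ≤ matNorm M v :=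
  Real.sqrt_nonneg _

lemma matNorm_sq (hM : M.PosDef) (v : Fin d → ℝ) : matNorm M v ^ 2 = v ⬝ᵥ (M *ᵥ v) := by
  have h := hM.posSemidef.dotProduct_mulVec_nonneg v
  rw [star_trivial] at h
  exact Real.sq_sqrt h

lemma matNorm_pos (hM : M.PosDef) (hv : v ≠ 0) : 0 < matNorm M v := by
  have h := hM.dotProduct_mulVec_pos hv
  rw [star_trivial] at h
  exact Real.sqrt_pos.2 h

lemma matNorm_smul (M : Matrix (Fin d) (Fin d) ℝ) (a : ℝ) (v : Fin d → ℝ) :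
    matNorm M (a • v) = |a| * matNorm M v := by
  have h : (a • v) ⬝ᵥ (M *ᵥ (a • v)) = a ^ 2 * (v ⬝ᵥ (M *ᵥ v)) := by
    simp [mulVec_smul, dotProduct_smul, smul_dotProduct]; ring
  rw [matNorm, h, Real.sqrt_mul (sq_nonneg a), Real.sqrt_sq_eq_abs, matNorm]

lemma matNorm_neg (M : Matrix (Fin d) (Fin d) ℝ) (v : Fin d → ℝ) :
    matNorm M (-v) = matNorm M v := by
  have h := matNorm_smul M (-1) v
  rwa [neg_one_smul, abs_neg, abs_one, one_mul] at h

lemma matNorm_zero (M : Matrix (Fin d) (Fin d) ℝ) : matNorm M 0 = 0 := by simp [matNorm]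

lemma dotProduct_mulVec_symm (hM : M.PosDef) (v w : Fin d → ℝ) :
    v ⬝ᵥ (M *ᵥ w) = w ⬝ᵥ (M *ᵥ v) := by
  have hT : Mᵀ = M := by simpa using hM.isHermitian.eq
  rw [dotProduct_mulVec, dotProduct_comm, ← mulVec_transpose, hT]

/-- The Cauchy–Schwarz inequality for the inner product of a positive definite matrix. -/
lemma dotProduct_mulVec_le (hM : M.PosDef) (v w : Fin d → ℝ) :
    v ⬝ᵥ (M *ᵥ w) ≤ matNorm M v * matNorm M w := by
  rcases eq_or_ne w 0 with rfl | hw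
  · simp [matNorm_zero]
  have hw' := matNorm_pos hM hw
  have key : 0 ≤ (matNorm M w • v - matNorm M v • w) ⬝ᵥ
      (M *ᵥ (matNorm M w • v - matNorm M v • w)) := by
    rw [← matNorm_sq hM]; positivity
  have hexp : (matNorm M w • v - matNorm M v • w) ⬝ᵥ
      (M *ᵥ (matNorm M w • v - matNorm M v • w)) =
      2 * matNorm M w ^ 2 * matNorm M v ^ 2
        - 2 * (matNorm M v * matNorm M w) * (v ⬝ᵥ (M *ᵥ w)) := by
    simp only [mulVec_sub, mulVec_smul, sub_dotProduct, dotProduct_sub, smul_dotProduct,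
      dotProduct_smul, smul_eq_mul]
    rw [dotProduct_mulVec_symm hM w v, ← matNorm_sq hM, ← matNorm_sq hM]; ring
  rw [hexp] at key
  rcases eq_or_ne v 0 with rfl | hv
  · simp [matNorm_zero]
  have hv' := matNorm_pos hM hv
  have hvw : 0 < matNorm M v * matNorm M w := mul_pos hv' hw'
  nlinarith

lemma matNorm_add_le (hM : M.PosDef) (v w : Fin d → ℝ) :
    matNorm M (v + w) ≤ matNorm M v + matNorm M w := by
  refine abs_le_of_sq_le_sq' ?_ (add_nonneg (matNorm_nonneg _ _) (matNorm_nonneg _ _)) |>.2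
  have h : (v + w) ⬝ᵥ (M *ᵥ (v + w)) =
      matNorm M v ^ 2 + 2 * (v ⬝ᵥ (M *ᵥ w)) + matNorm M w ^ 2 := by
    simp only [mulVec_add, add_dotProduct, dotProduct_add]
    rw [dotProduct_mulVec_symm hM w v, ← matNorm_sq hM, ← matNorm_sq hM]; ring
  rw [matNorm_sq hM, h]
  nlinarith [dotProduct_mulVec_le hM v w]

lemma mulVec_inv_mulVec (hM : M.PosDef) (b : Fin d → ℝ) : M *ᵥ (M⁻¹ *ᵥ b) = b := by
  rw [mulVec_mulVec, mul_nonsing_inv _ ((isUnit_iff_isUnit_det M).1 hM.isUnit), one_mulVec]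

/-- The norm of `M⁻¹` is the dual norm of that of `M`. -/
lemma matNorm_inv_mulVec (hM : M.PosDef) (b : Fin d → ℝ) :
    matNorm M (M⁻¹ *ᵥ b) = matNorm M⁻¹ b := by
  rw [matNorm, matNorm, mulVec_inv_mulVec hM, dotProduct_comm]

lemma abs_dotProduct_le (hM : M.PosDef) (b v : Fin d → ℝ) :
    |b ⬝ᵥ v| ≤ matNorm M⁻¹ b * matNorm M v := by
  have h : ∀ b : Fin d → ℝ, b ⬝ᵥ v ≤ matNorm M⁻¹ b * matNorm M v := fun b => by
    have := dotProduct_mulVec_le hM v (M⁻¹ *ᵥ b)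
    rwa [mulVec_inv_mulVec hM, matNorm_inv_mulVec hM, dotProduct_comm, mul_comm] at this
  refine abs_le'.2 ⟨h b, ?_⟩
  have := h (-b)
  rwa [neg_dotProduct, matNorm_neg] at this

lemma matNorm_inv_sq (hM : M.PosDef) (b : Fin d → ℝ) :
    matNorm M⁻¹ b ^ 2 = b ⬝ᵥ (M⁻¹ *ᵥ b) :=
  matNorm_sq hM.inv b

/-- Dual norms are antitone in the primal norm. -/
lemma matNorm_inv_le_of_le (hA : A.PosDef) (hB : B.PosDef) {k : ℝ}
    (h : ∀ v, matNorm A v ≤ k * matNorm B v) (b : Fin d → ℝ) :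
    matNorm B⁻¹ b ≤ k * matNorm A⁻¹ b := by
  rcases eq_or_ne b 0 with rfl | hb
  · simp [matNorm_zero]
  -- Test against `B⁻¹ b`, where the dual norm of `b` is attained, and cancel one factor `‖b‖` in
  -- the norm of `B⁻¹`.
  have hpos := matNorm_pos hB.inv hb
  have h1 := (le_abs_self _).trans (abs_dotProduct_le hA b (B⁻¹ *ᵥ b))
  have h2 := mul_le_mul_of_nonneg_left (h (B⁻¹ *ᵥ b)) (matNorm_nonneg A⁻¹ b)
  rw [← matNorm_inv_sq hB] at h1
  rw [matNorm_inv_mulVec hB] at h2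
  nlinarith

lemma LoewnerLE.dotProduct_le (h : LoewnerLE A B) (v : Fin d → ℝ) :
    v ⬝ᵥ (A *ᵥ v) ≤ v ⬝ᵥ (B *ᵥ v) := by
  have := PosSemidef.dotProduct_mulVec_nonneg h v
  rw [star_trivial, sub_mulVec, dotProduct_sub] at this
  linarith

lemma LoewnerLE.matNorm_le (h : LoewnerLE A B) (v : Fin d → ℝ) : matNorm A v ≤ matNorm B v :=
  Real.sqrt_le_sqrt (h.dotProduct_le v)

lemma LoewnerLE.matNorm_le_sqrt_mul {C : ℝ} (hC : 0 ≤ C) (h : LoewnerLE A (C • B))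
    (v : Fin d → ℝ) : matNorm A v ≤ √C * matNorm B v := by
  refine (h.matNorm_le v).trans_eq ?_
  rw [matNorm, smul_mulVec, dotProduct_smul, smul_eq_mul, Real.sqrt_mul hC, matNorm]

/-- Approximate Hessians are not assumed symmetric: symmetry follows from `A = B - (B - A)`,
positivity from `B ⪯ C A`. -/
lemma LoewnerLE.posDef {C : ℝ} (hC : 0 < C) (hB : B.PosDef) (h₁ : LoewnerLE A B)
    (h₂ : LoewnerLE B (C • A)) : A.PosDef := by
  have hherm : A.IsHermitian := by
    have := hB.isHermitian.sub (PosSemidef.isHermitian h₁)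
    rwa [sub_sub_cancel] at this
  refine PosDef.of_dotProduct_mulVec_pos hherm fun v hv => ?_
  have h := h₂.dotProduct_le v
  have h' := hB.dotProduct_mulVec_pos hv
  rw [star_trivial] at h' ⊢
  rw [smul_mulVec, dotProduct_smul, smul_eq_mul] at h
  exact pos_of_mul_pos_right (h'.trans_le h) hC.le

end MatNorm

/-! ### Comparison of functions by their derivatives -/

/-- Replaces integration: estimates follow by comparison with an explicit antiderivative, with no
integrability to check. -/
lemma sub_le_sub_of_hasDerivAt_le {F G F' G' : ℝ → ℝ} {T : ℝ}
    (hF : ∀ s ∈ Set.Icc 0 T, HasDerivAt F (F' s) s)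
    (hG : ∀ s ∈ Set.Icc 0 T, HasDerivAt G (G' s) s)
    (h : ∀ s ∈ Set.Icc 0 T, F' s ≤ G' s) :
    ∀ s ∈ Set.Icc 0 T, F s - F 0 ≤ G s - G 0 := by
  intro s hs
  have hd : ∀ s ∈ Set.Icc 0 T, HasDerivAt (fun s => G s - F s) (G' s - F' s) s :=
    fun s hs => (hG s hs).sub (hF s hs)
  have hmono : MonotoneOn (fun s => G s - F s) (Set.Icc 0 T) := by
    refine monotoneOn_of_deriv_nonneg (convex_Icc 0 T)
      (fun s hs => (hd s hs).continuousAt.continuousWithinAt)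
      (fun s hs => (hd s (interior_subset hs)).differentiableAt.differentiableWithinAt)
      fun s hs => ?_
    rw [(hd s (interior_subset hs)).deriv]
    exact sub_nonneg.2 (h s (interior_subset hs))
  have := hmono ⟨le_rfl, hs.1.trans hs.2⟩ hs hs.1
  simp only at this
  linarith

end ApproxIPM
namespace ApproxIPM

/-! ### Self-concordant functions along segments -/

section SelfConcordant

variable {d : ℕ} {D : Set (Fin d → ℝ)} {f : (Fin d → ℝ) → ℝ} {x y v : Fin d → ℝ}

lemma grad_dotProduct (f : (Fin d → ℝ) → ℝ) (x v : Fin d → ℝ) :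
    grad f x ⬝ᵥ v = fderiv ℝ f x v := by
  conv_rhs => rw [pi_eq_sum_univ' v]
  simp only [map_sum, map_smul, dotProduct, grad, smul_eq_mul]
  refine Finset.sum_congr rfl fun i _ => ?_
  rw [mul_comm]

lemma dotProduct_hess (f : (Fin d → ℝ) → ℝ) (x v w : Fin d → ℝ) :
    v ⬝ᵥ (hess f x *ᵥ w) = fderiv ℝ (fderiv ℝ f) x v w := by
  conv_rhs => rw [pi_eq_sum_univ' v, pi_eq_sum_univ' w]
  simp only [map_sum, map_smul, dotProduct, mulVec, hess, _root_.sum_apply,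
    smul_eq_mul, of_apply, Finset.mul_sum, _root_.smul_apply]
  rw [Finset.sum_comm]
  refine Finset.sum_congr rfl fun i _ => Finset.sum_congr rfl fun j _ => ?_
  ring

lemma hasDerivAt_add_smul (x v : Fin d → ℝ) (s : ℝ) :
    HasDerivAt (fun s : ℝ => x + s • v) v s := by
  simpa using ((hasDerivAt_id s).smul_const v).const_add x

lemma IsSelfConcordant.hasFDerivAt (hf : IsSelfConcordant D f) (hD : IsOpen D) (hx : x ∈ D) :
    HasFDerivAt f (fderiv ℝ f x) x :=
  ((hf.contDiffOn.contDiffAt (hD.mem_nhds hx)).differentiableAt (by norm_num)).hasFDerivAt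

lemma IsSelfConcordant.hasFDerivAt_fderiv (hf : IsSelfConcordant D f) (hD : IsOpen D)
    (hx : x ∈ D) : HasFDerivAt (fderiv ℝ f) (fderiv ℝ (fderiv ℝ f) x) x :=
  (((hf.contDiffOn.contDiffAt (hD.mem_nhds hx)).fderiv_right (m := 1)
    (by norm_num)).differentiableAt (by norm_num)).hasFDerivAt

lemma IsSelfConcordant.hasDerivAt_line (hf : IsSelfConcordant D f) (hD : IsOpen D) {s : ℝ}
    (hx : x + s • v ∈ D) :
    HasDerivAt (fun s : ℝ => f (x + s • v)) (grad f (x + s • v) ⬝ᵥ v) s := by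
  rw [grad_dotProduct]
  exact (hf.hasFDerivAt hD hx).comp_hasDerivAt s (hasDerivAt_add_smul x v s)

lemma IsSelfConcordant.hasDerivAt_grad_line (hf : IsSelfConcordant D f) (hD : IsOpen D) {s : ℝ}
    (hx : x + s • v ∈ D) :
    HasDerivAt (fun s : ℝ => grad f (x + s • v) ⬝ᵥ v) (localNorm f (x + s • v) v ^ 2) s := by
  simp only [grad_dotProduct]
  rw [localNorm, matNorm_sq (hf.posDef _ hx), dotProduct_hess]
  exact (ContinuousLinearMap.apply ℝ ℝ v).hasFDerivAt.comp_hasDerivAt s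
    ((hf.hasFDerivAt_fderiv hD hx).comp_hasDerivAt s (hasDerivAt_add_smul x v s))

lemma localNorm_smul (f : (Fin d → ℝ) → ℝ) (x : Fin d → ℝ) (a : ℝ) (v : Fin d → ℝ) :
    localNorm f x (a • v) = |a| * localNorm f x v :=
  matNorm_smul _ _ _

lemma localNorm_nonneg (f : (Fin d → ℝ) → ℝ) (x v : Fin d → ℝ) : 0 ≤ localNorm f x v :=
  matNorm_nonneg _ _

lemma IsSelfConcordant.localNorm_pos (hf : IsSelfConcordant D f) (hx : x ∈ D) (hv : v ≠ 0) :
    0 < localNorm f x v :=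
  matNorm_pos (hf.posDef x hx) hv

lemma IsSelfConcordant.mul_localNorm_le (hf : IsSelfConcordant D f) (hx : x ∈ D)
    (hy : localNorm f x (y - x) < 1) (v : Fin d → ℝ) :
    (1 - localNorm f x (y - x)) * localNorm f y v ≤ localNorm f x v := by
  rcases eq_or_ne v 0 with rfl | hv
  · simp [localNorm, matNorm_zero]
  have h := (hf.ratio x hx y hy v hv).2
  rw [div_le_div_iff₀ (hf.localNorm_pos hx hv) (by linarith)] at h
  linarith

/-- Along a line the reciprocal of the local norm of the direction grows with slope at most
one. -/
lemma IsSelfConcordant.localNorm_le_line (hf : IsSelfConcordant D f) {s : ℝ} (hs : 0 ≤ s)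
    (hx : x + s • v ∈ D) :
    localNorm f x v ≤ (1 + s * localNorm f x v) * localNorm f (x + s • v) v := by
  have hr := localNorm_nonneg f x v
  have hN := localNorm_nonneg f (x + s • v) v
  have hdist : localNorm f (x + s • v) (x - (x + s • v)) = s * localNorm f (x + s • v) v := by
    rw [sub_add_cancel_left, ← neg_smul, localNorm_smul, abs_neg, abs_of_nonneg hs]
  -- The ratio condition is centred at the far point `x + s v`. If `x` lies outside its unit ball,
  -- then `s‖v‖ ≥ 1` there and the claim is immediate.
  rcases lt_or_ge (s * localNorm f (x + s • v) v) 1 with h | h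
  · have := hf.mul_localNorm_le hx (hdist.trans_lt h) v
    rw [hdist] at this
    linarith
  · nlinarith [mul_le_mul_of_nonneg_left h hr]

lemma IsSelfConcordant.localNorm_line_le (hf : IsSelfConcordant D f) (hx : x ∈ D) {s : ℝ}
    (hs : s ∈ Set.Icc (0 : ℝ) 1) (hr : localNorm f x v < 1) :
    (1 - localNorm f x v) * localNorm f (x + s • v) v ≤ localNorm f x v := by
  have hdist : localNorm f x (x + s • v - x) = s * localNorm f x v := by
    rw [add_sub_cancel_left, localNorm_smul, abs_of_nonneg hs.1]
  have hle : s * localNorm f x v ≤ localNorm f x v :=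
    mul_le_of_le_one_left (localNorm_nonneg _ _ _) hs.2
  have := hf.mul_localNorm_le hx (hdist.trans_lt (hle.trans_lt hr)) v
  rw [hdist] at this
  refine le_trans ?_ this
  exact mul_le_mul_of_nonneg_right (by linarith) (localNorm_nonneg _ _ _)

lemma line_mem (hconv : Convex ℝ D) (hx : x ∈ D) (hy : y ∈ D) {s : ℝ}
    (hs : s ∈ Set.Icc (0 : ℝ) 1) : x + s • (y - x) ∈ D :=
  hconv.add_smul_sub_mem hx hy hs

/-- The derivative of `g(x + s v)ᵀv` is the squared local norm of `v`, at least `(r/(1 + s r))²`,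
whose antiderivative is `s r²/(1 + s r)`. -/
lemma IsSelfConcordant.grad_line_sub_ge (hf : IsSelfConcordant D f) (hD : IsOpen D)
    (hconv : Convex ℝ D) (hx : x ∈ D) (hy : y ∈ D) {s : ℝ} (hs : s ∈ Set.Icc (0 : ℝ) 1) :
    s * localNorm f x (y - x) ^ 2 / (1 + s * localNorm f x (y - x)) ≤
      grad f (x + s • (y - x)) ⬝ᵥ (y - x) - grad f x ⬝ᵥ (y - x) := by
  set v := y - x with hv
  set r := localNorm f x v with hr
  have hr0 : 0 ≤ r := localNorm_nonneg _ _ _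
  have hF : ∀ s ∈ Set.Icc (0 : ℝ) 1,
      HasDerivAt (fun s : ℝ => s * r ^ 2 / (1 + s * r)) (r ^ 2 / (1 + s * r) ^ 2) s := by
    intro s hs
    have hne : 1 + s * r ≠ 0 := (add_pos_of_pos_of_nonneg one_pos (mul_nonneg hs.1 hr0)).ne'
    have := ((hasDerivAt_id s).mul_const (r ^ 2)).div
      (((hasDerivAt_id s).mul_const r).const_add 1) hne
    refine this.congr_deriv ?_
    simp only [id]
    ring
  have := sub_le_sub_of_hasDerivAt_le hF
    (fun s hs => hf.hasDerivAt_grad_line hD (line_mem hconv hx hy hs)) (fun s hs => ?_) s hs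
  · simpa only [zero_mul, zero_smul, add_zero, zero_div, sub_zero] using this
  · have h1 : 0 < 1 + s * r := add_pos_of_pos_of_nonneg one_pos (mul_nonneg hs.1 hr0)
    rw [← div_pow]
    refine pow_le_pow_left₀ (by positivity) ?_ 2
    rw [div_le_iff₀ h1, mul_comm]
    exact hf.localNorm_le_line hs.1 (line_mem hconv hx hy hs)

/-- Strong monotonicity of the gradient of a self-concordant function. -/
lemma IsSelfConcordant.grad_sub_ge (hf : IsSelfConcordant D f) (hD : IsOpen D)
    (hconv : Convex ℝ D) (hx : x ∈ D) (hy : y ∈ D) :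
    localNorm f x (y - x) ^ 2 / (1 + localNorm f x (y - x)) ≤
      grad f y ⬝ᵥ (y - x) - grad f x ⬝ᵥ (y - x) := by
  simpa using hf.grad_line_sub_ge hD hconv hx hy ⟨zero_le_one, le_rfl⟩

/-- The global lower bound for a self-concordant function. -/
lemma IsSelfConcordant.sub_ge (hf : IsSelfConcordant D f) (hD : IsOpen D)
    (hconv : Convex ℝ D) (hx : x ∈ D) (hy : y ∈ D) :
    grad f x ⬝ᵥ (y - x) + localNorm f x (y - x) - Real.log (1 + localNorm f x (y - x)) ≤
      f y - f x := by
  set v := y - x with hv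
  set r := localNorm f x v with hr
  have hr0 : 0 ≤ r := localNorm_nonneg _ _ _
  have hF : ∀ s ∈ Set.Icc (0 : ℝ) 1,
      HasDerivAt (fun s : ℝ => s * (grad f x ⬝ᵥ v) + s * r - Real.log (1 + s * r))
        (grad f x ⬝ᵥ v + s * r ^ 2 / (1 + s * r)) s := by
    intro s hs
    have hne : 1 + s * r ≠ 0 := (add_pos_of_pos_of_nonneg one_pos (mul_nonneg hs.1 hr0)).ne'
    have := (((hasDerivAt_id s).mul_const (grad f x ⬝ᵥ v)).add
      ((hasDerivAt_id s).mul_const r)).sub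
      ((((hasDerivAt_id s).mul_const r).const_add 1).log hne)
    refine this.congr_deriv ?_
    have h : r - r / (1 + s * r) = s * r ^ 2 / (1 + s * r) := by
      rw [eq_div_iff hne, sub_mul, div_mul_cancel₀ _ hne]; ring
    simp only [id, one_mul]
    rw [← h, add_sub_assoc]
  have := sub_le_sub_of_hasDerivAt_le hF
    (fun s hs => hf.hasDerivAt_line hD (line_mem hconv hx hy hs)) (fun s hs => ?_)
    1 ⟨zero_le_one, le_rfl⟩
  · simpa [hv] using this
  · linarith [hf.grad_line_sub_ge hD hconv hx hy hs]

/-- The quadratic upper bound for a self-concordant function on its Dikin ellipsoid. -/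
lemma IsSelfConcordant.sub_le (hf : IsSelfConcordant D f) (hD : IsOpen D)
    (hx : x ∈ D) (hr : localNorm f x v < 1) :
    f (x + v) - f x ≤
      grad f x ⬝ᵥ v + (localNorm f x v / (1 - localNorm f x v)) ^ 2 / 2 := by
  set r := localNorm f x v with hr'
  have hr0 : 0 ≤ r := localNorm_nonneg _ _ _
  have hmem : ∀ s ∈ Set.Icc (0 : ℝ) 1, x + s • v ∈ D := fun s hs => by
    refine hf.ball_subset x hx ?_
    rw [Set.mem_ofPred_eq, add_sub_cancel_left, localNorm_smul, abs_of_nonneg hs.1]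
    exact (mul_le_of_le_one_left hr0 hs.2).trans_lt hr
  -- A uniform bound on the second derivative along the segment; integrating it twice gives `M/2`.
  set M := (r / (1 - r)) ^ 2 with hM
  have h1 : ∀ s ∈ Set.Icc (0 : ℝ) 1,
      grad f (x + s • v) ⬝ᵥ v - grad f x ⬝ᵥ v ≤ s * M := fun s hs => by
    have := sub_le_sub_of_hasDerivAt_le
      (fun s hs => hf.hasDerivAt_grad_line hD (hmem s hs))
      (fun s _ => (hasDerivAt_id s).mul_const M) (fun s hs => ?_) s hs
    · simpa using this
    · rw [one_mul]
      refine pow_le_pow_left₀ (localNorm_nonneg _ _ _) ?_ 2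
      rw [le_div_iff₀ (by linarith), mul_comm]
      exact hf.localNorm_line_le hx hs hr
  have := sub_le_sub_of_hasDerivAt_le
    (fun s hs => hf.hasDerivAt_line hD (hmem s hs))
    (G := fun s => s * (grad f x ⬝ᵥ v) + s ^ 2 * (M / 2))
    (G' := fun s => grad f x ⬝ᵥ v + s * M) (fun s _ => ?_) (fun s hs => ?_)
    1 ⟨zero_le_one, le_rfl⟩
  · simpa using this
  · refine (((hasDerivAt_id s).mul_const (grad f x ⬝ᵥ v)).add
      ((hasDerivAt_pow 2 s).mul_const (M / 2))).congr_deriv ?_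
    norm_num
    ring
  · linarith [h1 s hs]

/-- For a barrier of complexity at most `ϑ`, `g(x)ᵀ(y - x) ≤ ϑ`. -/
lemma IsSelfConcordant.grad_dotProduct_sub_le (hf : IsSelfConcordant D f) (hD : IsOpen D)
    (hconv : Convex ℝ D) {ϑ : ℝ} (hϑ : 0 < ϑ)
    (hbound : ∀ x ∈ D, matNorm (hess f x)⁻¹ (grad f x) ≤ √ϑ) (hx : x ∈ D) (hy : y ∈ D) :
    grad f x ⬝ᵥ (y - x) ≤ ϑ := by
  set v := y - x with hv
  rcases le_or_gt (grad f x ⬝ᵥ v) 0 with h0 | h0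
  · exact h0.trans hϑ.le
  have hmem : ∀ s ∈ Set.Icc (0 : ℝ) 1, x + s • v ∈ D := fun s hs => line_mem hconv hx hy hs
  have hpos : ∀ s ∈ Set.Icc (0 : ℝ) 1, 0 < grad f (x + s • v) ⬝ᵥ v := fun s hs => by
    have := sub_le_sub_of_hasDerivAt_le (fun s _ => hasDerivAt_const s (0 : ℝ))
      (fun s hs => hf.hasDerivAt_grad_line hD (hmem s hs)) (fun s hs => sq_nonneg _) s hs
    simp only [sub_self, zero_smul, add_zero] at this
    linarith
  -- With `φ(s) = g(x + s v)ᵀv`, Cauchy–Schwarz gives `φ² ≤ ϑ φ'`, so `-1/φ` has slope at least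
  -- `1/ϑ`. As `φ` stays positive up to `s = 1`, `1/ϑ < 1/φ(0)`.
  have key := sub_le_sub_of_hasDerivAt_le (fun s _ => (hasDerivAt_id s).mul_const (1 / ϑ))
    (fun s hs => ((hf.hasDerivAt_grad_line hD (hmem s hs)).inv (hpos s hs).ne').neg)
    (fun s hs => ?_) 1 ⟨zero_le_one, le_rfl⟩
  · simp only [id, zero_mul, sub_zero, one_mul] at key
    have h1 : 0 < (grad f (x + v) ⬝ᵥ v)⁻¹ := by
      have := hpos 1 ⟨zero_le_one, le_rfl⟩
      rw [one_smul] at this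
      exact inv_pos.2 this
    have key' : 1 / ϑ ≤ 1 / (grad f x ⬝ᵥ v) := by
      rw [one_div (grad f x ⬝ᵥ v)]
      simp only [Pi.neg_apply, Pi.inv_apply, one_smul, zero_smul, add_zero] at key
      linarith
    exact (one_div_le_one_div hϑ h0).1 key'
  · have hp := hpos s hs
    rw [one_mul, ← neg_div, neg_neg, div_le_div_iff₀ hϑ (by positivity), one_mul]
    have h := (le_abs_self _).trans
      (abs_dotProduct_le (hf.posDef _ (hmem s hs)) (grad f (x + s • v)) v)
    have h2 := h.trans (mul_le_mul_of_nonneg_right (hbound _ (hmem s hs)) (matNorm_nonneg _ _))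
    have h3 := pow_le_pow_left₀ hp.le h2 2
    rw [mul_pow, Real.sq_sqrt hϑ.le] at h3
    rw [mul_comm]
    exact h3

end SelfConcordant

end ApproxIPM
namespace ApproxIPM

/-! ### The penalized objective -/

section Penalized

variable {d : ℕ} {D : Set (Fin d → ℝ)} {f : (Fin d → ℝ) → ℝ} {c x y z : Fin d → ℝ} {η : ℝ}

/-- The Newton decrement `‖n_η(x)‖_x` of `f_η`, as the dual norm of its gradient. -/
noncomputable def decrement (c : Fin d → ℝ) (f : (Fin d → ℝ) → ℝ) (η : ℝ) (x : Fin d → ℝ) : ℝ :=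
  matNorm (hess f x)⁻¹ (η • c + grad f x)

lemma decrement_nonneg (c : Fin d → ℝ) (f : (Fin d → ℝ) → ℝ) (η : ℝ) (x : Fin d → ℝ) :
    0 ≤ decrement c f η x :=
  matNorm_nonneg _ _

lemma penalized_sub (c : Fin d → ℝ) (f : (Fin d → ℝ) → ℝ) (η : ℝ) (x y : Fin d → ℝ) :
    penalized c f η y - penalized c f η x = η * (c ⬝ᵥ (y - x)) + (f y - f x) := by
  simp only [penalized, dotProduct_sub]; ring

lemma hasFDerivAt_linear (c x : Fin d → ℝ) (η : ℝ) :
    HasFDerivAt (fun y => η * (c ⬝ᵥ y))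
      (η • LinearMap.toContinuousLinearMap (dotProductBilin ℝ ℝ c)) x := by
  have h : HasFDerivAt (fun y => c ⬝ᵥ y)
      (LinearMap.toContinuousLinearMap (dotProductBilin ℝ ℝ c)) x :=
    (LinearMap.toContinuousLinearMap (dotProductBilin ℝ ℝ c)).hasFDerivAt
  exact h.const_mul η

lemma IsSelfConcordant.fderiv_penalized (hf : IsSelfConcordant D f) (hD : IsOpen D) (hx : x ∈ D) :
    fderiv ℝ (penalized c f η) x =
      η • LinearMap.toContinuousLinearMap (dotProductBilin ℝ ℝ c) + fderiv ℝ f x :=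
  ((hasFDerivAt_linear c x η).add (hf.hasFDerivAt hD hx)).fderiv

lemma IsSelfConcordant.grad_penalized (hf : IsSelfConcordant D f) (hD : IsOpen D) (hx : x ∈ D) :
    grad (penalized c f η) x = η • c + grad f x := by
  ext i
  simp [grad, hf.fderiv_penalized hD hx]

lemma IsSelfConcordant.hess_penalized (hf : IsSelfConcordant D f) (hD : IsOpen D) (hx : x ∈ D) :
    hess (penalized c f η) x = hess f x := by
  have h : fderiv ℝ (penalized c f η) =ᶠ[𝓝 x]
      fun y => η • LinearMap.toContinuousLinearMap (dotProductBilin ℝ ℝ c) + fderiv ℝ f y := by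
    filter_upwards [hD.mem_nhds hx] with y hy
    exact hf.fderiv_penalized hD hy
  ext i j
  simp only [hess, of_apply]
  rw [h.fderiv_eq, fderiv_const_add]

lemma IsSelfConcordant.localNorm_newtonStep_penalized (hf : IsSelfConcordant D f)
    (hD : IsOpen D) (hx : x ∈ D) :
    localNorm (penalized c f η) x (newtonStep (penalized c f η) x) = decrement c f η x := by
  rw [localNorm, newtonStep, hf.hess_penalized hD hx, hf.grad_penalized hD hx, matNorm_neg,
    matNorm_inv_mulVec (hf.posDef x hx), decrement]

lemma IsSelfConcordant.abs_gradient_le (hf : IsSelfConcordant D f) (hx : x ∈ D)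
    (v : Fin d → ℝ) :
    |η * (c ⬝ᵥ v) + grad f x ⬝ᵥ v| ≤ decrement c f η x * localNorm f x v := by
  have := abs_dotProduct_le (hf.posDef x hx) (η • c + grad f x) v
  rwa [add_dotProduct, smul_dotProduct, smul_eq_mul] at this

/-- A point with a small Newton decrement is almost optimal. -/
lemma IsSelfConcordant.penalized_ge (hf : IsSelfConcordant D f) (hD : IsOpen D)
    (hconv : Convex ℝ D) (hx : x ∈ D) (hy : y ∈ D) (hdec : decrement c f η x ≤ 1 / 4) :
    penalized c f η x - 1 / 12 ≤ penalized c f η y := by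
  have hr := localNorm_nonneg f x (y - x)
  have h1 := hf.sub_ge hD hconv hx hy
  have h2 := (abs_le.1 (hf.abs_gradient_le (c := c) (η := η) hx (y - x))).1
  have h3 := mul_le_mul_of_nonneg_right hdec hr
  have h4 := penalized_sub c f η x y
  -- The tangent of `log` at 4/3 has slope 3/4 = 1 - 1/4, which cancels the linear terms; `log (4/3)
  -- ≤ 1/3` leaves 1/12.
  have h5 : Real.log (1 + localNorm f x (y - x)) ≤
      1 / 3 + ((1 + localNorm f x (y - x)) * (3 / 4) - 1) := by
    have e : 1 + localNorm f x (y - x) = 4 / 3 * ((1 + localNorm f x (y - x)) * (3 / 4)) := by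
      ring
    rw [e, Real.log_mul (by norm_num) (by positivity), ← e]
    refine add_le_add ?_ (Real.log_le_sub_one_of_pos (by positivity))
    have := Real.log_le_sub_one_of_pos (show (0 : ℝ) < 4 / 3 by norm_num)
    linarith
  linarith

/-- The decrease achieved by a damped exact Newton step of local length `s`. -/
lemma IsSelfConcordant.exists_penalized_le (hf : IsSelfConcordant D f) (hD : IsOpen D)
    (hx : x ∈ D) {s : ℝ} (hs : 0 ≤ s) (hs1 : s < 1) :
    ∃ y ∈ D, penalized c f η y ≤
      penalized c f η x - s * decrement c f η x + (s / (1 - s)) ^ 2 / 2 := by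
  rcases (decrement_nonneg c f η x).eq_or_lt with h0 | hpos
  · exact ⟨x, hx, by rw [← h0, mul_zero, sub_zero]; linarith [sq_nonneg (s / (1 - s))]⟩
  set b := η • c + grad f x with hb
  set v := (-(s / decrement c f η x)) • ((hess f x)⁻¹ *ᵥ b) with hv
  have hpd := hf.posDef x hx
  have hnorm : localNorm f x v = s := by
    rw [hv, localNorm_smul, localNorm, matNorm_inv_mulVec hpd, abs_neg,
      abs_of_nonneg (by positivity)]
    exact div_mul_cancel₀ s hpos.ne'
  have hbv : b ⬝ᵥ v = -(s * decrement c f η x) := by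
    rw [hv, dotProduct_smul, ← matNorm_inv_sq hpd, smul_eq_mul]
    change -(s / decrement c f η x) * decrement c f η x ^ 2 = _
    field_simp
  have h := hf.sub_le hD hx (hnorm.trans_lt hs1)
  have h' := penalized_sub c f η x (x + v)
  rw [add_sub_cancel_left] at h'
  rw [hb, add_dotProduct, smul_dotProduct, smul_eq_mul] at hbv
  refine ⟨x + v, hf.ball_subset x hx ?_, ?_⟩
  · rw [Set.mem_ofPred_eq, add_sub_cancel_left, hnorm]
    exact hs1
  · rw [hnorm] at h
    linarith

/-- A step of length 1/3 gains a third of the decrement less 1/8. The gain is at most 1/12, so the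
decrement is at most 5/8. -/
lemma IsSelfConcordant.decrement_lt_one (hf : IsSelfConcordant D f) (hD : IsOpen D)
    (hx : x ∈ D) (hgap : ∀ y ∈ D, penalized c f η x - 1 / 12 ≤ penalized c f η y) :
    decrement c f η x < 1 := by
  obtain ⟨y, hy, h⟩ := hf.exists_penalized_le (c := c) (η := η) hD hx
    (s := 1 / 3) (by norm_num) (by norm_num)
  have := hgap y hy
  norm_num at h
  linarith

/-- The first-order condition: otherwise a short Newton step, with quadratic loss at most half its
linear gain, would go below the minimum. -/
lemma IsSelfConcordant.decrement_eq_zero (hf : IsSelfConcordant D f) (hD : IsOpen D)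
    (hx : x ∈ D) (hmin : ∀ y ∈ D, penalized c f η x ≤ penalized c f η y) :
    decrement c f η x = 0 := by
  by_contra hne
  have hpos : 0 < decrement c f η x := (decrement_nonneg c f η x).lt_of_ne' hne
  set s := min (1 / 2) (decrement c f η x / 4) with hs
  have hs0 : 0 < s := lt_min (by norm_num) (by positivity)
  have hs1 : s ≤ 1 / 2 := min_le_left _ _
  have hs2 : s ≤ decrement c f η x / 4 := min_le_right _ _
  obtain ⟨y, hy, h⟩ := hf.exists_penalized_le (c := c) (η := η) hD hx hs0.le (by linarith)
  have h1 := hmin y hy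
  have h2 : s / (1 - s) ≤ 2 * s := by
    rw [div_le_iff₀ (by linarith)]; nlinarith
  have h3 : (s / (1 - s)) ^ 2 ≤ (2 * s) ^ 2 :=
    pow_le_pow_left₀ (div_nonneg hs0.le (by linarith)) h2 2
  nlinarith

/-! ### The complexity of a barrier -/

lemma IsSelfConcordantBarrier.matNorm_grad_le (hf : IsSelfConcordantBarrier D f) (hx : x ∈ D) :
    matNorm (hess f x)⁻¹ (grad f x) ≤ √(complexity D f) := by
  refine Real.le_sqrt_of_sq_le ?_
  rw [← matNorm_inv_mulVec (hf.selfConcordant.posDef x hx)]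
  exact le_csSup hf.complexity_finite ⟨x, hx, rfl⟩

/-- Move along `v` of local norm 1/2 on which the gradient is nonnegative. Strong monotonicity gives
`g(x+v)ᵀv ≥ 1/6`, while `v` has local norm at most 1 at `x + v`. This rules out `ϑ = 0` and bounds
the relative increase of `η`. -/
lemma IsSelfConcordantBarrier.sqrt_complexity_ge (hf : IsSelfConcordantBarrier D f)
    (hd : 0 < d) (hD : IsOpen D) (hconv : Convex ℝ D) (hx : x ∈ D) :
    1 / 6 ≤ √(complexity D f) := by
  have hsc := hf.selfConcordant
  obtain ⟨v, hv, hg⟩ : ∃ v : Fin d → ℝ, localNorm f x v = 1 / 2 ∧ 0 ≤ grad f x ⬝ᵥ v := by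
    set e : Fin d → ℝ := Pi.single ⟨0, hd⟩ 1 with he
    have hne : e ≠ 0 := by simp [he]
    have hpos := hsc.localNorm_pos hx hne
    set a : ℝ := 1 / 2 / localNorm f x e
    have ha : 0 ≤ a := by positivity
    have hn : a * localNorm f x e = 1 / 2 := div_mul_cancel₀ _ hpos.ne'
    rcases le_total 0 (grad f x ⬝ᵥ e) with h | h
    · exact ⟨a • e, by rw [localNorm_smul, abs_of_nonneg ha, hn],
        by rw [dotProduct_smul]; exact mul_nonneg ha h⟩
    · refine ⟨(-a) • e, by rw [localNorm_smul, abs_neg, abs_of_nonneg ha, hn], ?_⟩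
      rw [dotProduct_smul, smul_eq_mul]
      nlinarith
  have hmem : x + v ∈ D := hsc.ball_subset x hx (by
    rw [Set.mem_ofPred_eq, add_sub_cancel_left, hv]; norm_num)
  have h1 := hsc.grad_sub_ge hD hconv hx hmem
  have h2 := (le_abs_self _).trans (abs_dotProduct_le (hsc.posDef _ hmem) (grad f (x + v)) v)
  have h3 := hsc.localNorm_line_le hx (s := 1) ⟨zero_le_one, le_rfl⟩ (v := v)
    (by rw [hv]; norm_num)
  rw [add_sub_cancel_left, hv] at h1
  rw [one_smul, hv] at h3
  change _ ≤ _ * localNorm f (x + v) v at h2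
  have h4 := mul_le_mul (hf.matNorm_grad_le hmem) (show localNorm f (x + v) v ≤ 1 by linarith)
    (localNorm_nonneg _ _ _) (Real.sqrt_nonneg _)
  norm_num at h1
  linarith

/-- The central path is nonempty at every parameter. -/
lemma IsSelfConcordantBarrier.exists_isMin (hf : IsSelfConcordantBarrier D f) (hD : IsOpen D)
    (hbdd : Bornology.IsBounded D) (c : Fin d → ℝ) (η : ℝ) (hx : x ∈ D) :
    ∃ z ∈ D, ∀ y ∈ D, penalized c f η z ≤ penalized c f η y := by
  have hlin : Continuous fun y : Fin d → ℝ => η * (c ⬝ᵥ y) :=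
    continuous_iff_continuousAt.2 fun y => (hasFDerivAt_linear c y η).continuousAt
  have hcont : ∀ y ∈ D, ContinuousAt (penalized c f η) y := fun y hy =>
    hlin.continuousAt.add (hf.selfConcordant.hasFDerivAt hD hy).continuousAt
  set S : Set (Fin d → ℝ) := {y | y ∈ D ∧ penalized c f η y ≤ penalized c f η x} with hS
  have hSD : S ⊆ D := fun y hy => hy.1
  have hclosed : IsClosed S := by
    refine isClosed_of_closure_subset fun p hp => ?_
    have hfreq := mem_closure_iff_frequently.1 hp
    -- The barrier keeps limits of the sublevel set off the boundary, since the linear term stays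
    -- bounded near `p`.
    have hpD : p ∈ D := by
      by_contra hpD
      have hfr : p ∈ frontier D := by
        rw [hD.frontier_eq]
        exact ⟨closure_mono hSD hp, hpD⟩
      have ht : Tendsto (penalized c f η) (𝓝[D] p) atTop :=
        (hlin.continuousAt.mono_left nhdsWithin_le_nhds).add_atTop (hf.tendsto_boundary p hfr)
      have hev := eventually_nhdsWithin_iff.1 (ht.eventually_gt_atTop (penalized c f η x))
      obtain ⟨y, hy, hy'⟩ := (hfreq.and_eventually hev).exists
      exact (hy' hy.1).not_ge hy.2
    refine ⟨hpD, not_lt.1 fun hlt => ?_⟩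
    obtain ⟨y, hy, hy'⟩ :=
      (hfreq.and_eventually ((hcont p hpD).eventually (lt_mem_nhds hlt))).exists
    exact hy'.not_ge hy.2
  have hcompact : IsCompact S := Metric.isCompact_of_isClosed_isBounded hclosed (hbdd.subset hSD)
  obtain ⟨z, hz, hmin⟩ := hcompact.exists_isMinOn ⟨x, hx, le_rfl⟩
    (fun y hy => (hcont y hy.1).continuousWithinAt)
  refine ⟨z, hz.1, fun y hy => ?_⟩
  rcases le_total (penalized c f η y) (penalized c f η x) with h | h
  · exact hmin ⟨hy, h⟩
  · exact hz.2.trans h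

/-- A point close to the central path is nearly optimal for the linear objective. -/
lemma IsSelfConcordantBarrier.dotProduct_le (hf : IsSelfConcordantBarrier D f) (hd : 0 < d)
    (hD : IsOpen D) (hconv : Convex ℝ D) (hbdd : Bornology.IsBounded D) (hη : 0 < η) {ε : ℝ}
    (hε : 2 * complexity D f ≤ ε * η) (hx : x ∈ D) (hy : y ∈ D)
    (hdec : decrement c f η x ≤ 5 / 128) :
    c ⬝ᵥ x ≤ c ⬝ᵥ y + ε := by
  have hsc := hf.selfConcordant
  have hsqrt := hf.sqrt_complexity_ge hd hD hconv hx
  have hϑ : 0 < complexity D f := Real.sqrt_pos.1 (by linarith)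
  obtain ⟨z, hz, hmin⟩ := hf.exists_isMin hD hbdd c η hx
  have hz0 := hsc.decrement_eq_zero hD hz hmin
  have hgrad : ∀ v, η * (c ⬝ᵥ v) = -(grad f z ⬝ᵥ v) := fun v => by
    have := hsc.abs_gradient_le (c := c) (η := η) hz v
    rw [hz0, zero_mul] at this
    linarith [abs_eq_zero.1 (this.antisymm (abs_nonneg _))]
  have h1 := hsc.grad_dotProduct_sub_le hD hconv hϑ (fun x hx => hf.matNorm_grad_le hx) hz hy
  -- Strong monotonicity between `x` and `z` gives `r/(1 + r) ≤ δ` if `r > 0`, so `r ≤ δ/(1 - δ)`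
  -- with `δ = 5/128`.
  have hr : localNorm f x (z - x) ≤ 5 / 123 := by
    have hr0 := localNorm_nonneg f x (z - x)
    have h2 := hsc.grad_sub_ge hD hconv hx hz
    have h3 := (abs_le.1 (hsc.abs_gradient_le (c := c) (η := η) hx (z - x))).1
    have h4 := mul_le_mul_of_nonneg_right hdec hr0
    have h5 := hgrad (z - x)
    have h6 : localNorm f x (z - x) ^ 2 / (1 + localNorm f x (z - x)) ≤
        5 / 128 * localNorm f x (z - x) := by linarith
    rw [div_le_iff₀ (by linarith)] at h6
    by_contra! hlt
    nlinarith
  have hr' : localNorm f z (z - x) ≤ 1 / 6 := by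
    have := hsc.mul_localNorm_le hx (by linarith) (z - x)
    have h0 := localNorm_nonneg f z (z - x)
    nlinarith
  have h2 : grad f z ⬝ᵥ (z - x) ≤ complexity D f := by
    calc grad f z ⬝ᵥ (z - x) ≤ _ :=
          (le_abs_self _).trans (abs_dotProduct_le (hsc.posDef z hz) (grad f z) (z - x))
      _ ≤ √(complexity D f) * √(complexity D f) :=
          mul_le_mul (hf.matNorm_grad_le hz) (hr'.trans hsqrt) (localNorm_nonneg f z _)
            (Real.sqrt_nonneg _)
      _ = complexity D f := Real.mul_self_sqrt hϑ.le
  have h3 := hgrad (y - z)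
  have h4 := hgrad (z - x)
  simp only [dotProduct_sub] at h1 h2 h3 h4
  have h5 : η * (c ⬝ᵥ x) ≤ η * (c ⬝ᵥ y + ε) := by
    rw [mul_add, mul_comm η ε]
    linarith
  exact le_of_mul_le_mul_left h5 hη

end Penalized

end ApproxIPM
namespace ApproxIPM

/-! ### Approximate Newton steps -/

section ApproxStep

variable {d : ℕ} {D : Set (Fin d → ℝ)} {f : (Fin d → ℝ) → ℝ} {c x g : Fin d → ℝ}
  {Q : Matrix (Fin d) (Fin d) ℝ} {η C : ℝ}

/-- The approximate Newton step `-Q⁻¹ (η c + g)`. -/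
noncomputable def approxStep (c : Fin d → ℝ) (η : ℝ) (g : Fin d → ℝ)
    (Q : Matrix (Fin d) (Fin d) ℝ) : Fin d → ℝ :=
  -(Q⁻¹ *ᵥ (η • c + g))

/-- The quality required of the approximate gradient `g` and Hessian `Q` of `f` at `x`. -/
structure IsApprox (f : (Fin d → ℝ) → ℝ) (C : ℝ) (x g : Fin d → ℝ)
    (Q : Matrix (Fin d) (Fin d) ℝ) : Prop where
  gradient : matNorm (hess f x)⁻¹ (g - grad f x) ≤ 1 / (128 * √C)
  lower : LoewnerLE Q (hess f x)
  upper : LoewnerLE (hess f x) (C • Q)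

lemma IsApprox.posDef (h : IsApprox f C x g Q) (hC : 1 ≤ C) (hpd : (hess f x).PosDef) :
    Q.PosDef :=
  h.lower.posDef (by linarith) hpd h.upper

lemma matNorm_approxStep (hQ : Q.PosDef) :
    matNorm Q (approxStep c η g Q) = matNorm Q⁻¹ (η • c + g) := by
  rw [approxStep, matNorm_neg, matNorm_inv_mulVec hQ]

lemma IsApprox.matNorm_inv_le (h : IsApprox f C x g Q) (hC : 1 ≤ C) (hpd : (hess f x).PosDef)
    (b : Fin d → ℝ) : matNorm Q⁻¹ b ≤ √C * matNorm (hess f x)⁻¹ b :=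
  matNorm_inv_le_of_le hpd (h.posDef hC hpd)
    (h.upper.matNorm_le_sqrt_mul (by linarith)) b

/-- The factor `√C` lost in passing to the norm of `Q⁻¹` is why the gradient accuracy contains
`1/√C`. -/
lemma IsApprox.matNorm_inv_gradient_error_le (h : IsApprox f C x g Q) (hC : 1 ≤ C)
    (hpd : (hess f x).PosDef) : matNorm Q⁻¹ (g - grad f x) ≤ 1 / 128 := by
  have hσ : 0 < √C := Real.sqrt_pos.2 (by linarith)
  calc _ ≤ √C * matNorm (hess f x)⁻¹ (g - grad f x) := h.matNorm_inv_le hC hpd _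
    _ ≤ √C * (1 / (128 * √C)) := mul_le_mul_of_nonneg_left h.gradient hσ.le
    _ = 1 / 128 := by field_simp

lemma IsApprox.matNorm_approxStep_le (h : IsApprox f C x g Q) (hC : 1 ≤ C)
    (hpd : (hess f x).PosDef) :
    matNorm Q (approxStep c η g Q) ≤ √C * decrement c f η x + 1 / 128 := by
  have hQ := h.posDef hC hpd
  have e : η • c + g = (η • c + grad f x) + (g - grad f x) := by abel
  rw [matNorm_approxStep hQ, e]
  exact (matNorm_add_le hQ.inv _ _).trans
    (add_le_add (h.matNorm_inv_le hC hpd _) (h.matNorm_inv_gradient_error_le hC hpd))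

/-- This direction uses `Q ⪯ H` and loses no power of `C`, so the threshold 1/32 certifies 1/32 +
1/128 = 5/128. -/
lemma IsApprox.decrement_le (h : IsApprox f C x g Q) (hC : 1 ≤ C) (hpd : (hess f x).PosDef) :
    decrement c f η x ≤ matNorm Q (approxStep c η g Q) + 1 / 128 := by
  have hQ := h.posDef hC hpd
  have h1 : decrement c f η x ≤ 1 * matNorm Q⁻¹ (η • c + grad f x) :=
    matNorm_inv_le_of_le hQ hpd (fun v => by rw [one_mul]; exact h.lower.matNorm_le v) _
  have e : η • c + grad f x = (η • c + g) + -(g - grad f x) := by abel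
  have h2 := matNorm_add_le hQ.inv (η • c + g) (-(g - grad f x))
  rw [matNorm_neg, ← e, ← matNorm_approxStep (c := c) (η := η) (g := g) hQ] at h2
  linarith [h.matNorm_inv_gradient_error_le hC hpd]

/-- An approximate Newton step stays in the domain and decreases the penalized objective. -/
lemma IsApprox.step (h : IsApprox f C x g Q) (hf : IsSelfConcordant D f) (hD : IsOpen D)
    (hC : 1 ≤ C) (hx : x ∈ D) (hdec : decrement c f η x < 1)
    (hlarge : 1 / 32 ≤ matNorm Q (approxStep c η g Q)) :
    x + (1 / (4 * C)) • approxStep c η g Q ∈ D ∧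
      penalized c f η (x + (1 / (4 * C)) • approxStep c η g Q) ≤
        penalized c f η x - 1 / (16384 * C) := by
  have hpd := hf.posDef x hx
  have hQ := h.posDef hC hpd
  have hC0 : 0 < C := by linarith
  have hσ : 1 ≤ √C := Real.one_le_sqrt.2 hC
  have hσC : √C * √C = C := Real.mul_self_sqrt hC0.le
  set v := approxStep c η g Q with hv
  set p := matNorm Q v with hp
  set r := localNorm f x ((1 / (4 * C)) • v) with hr
  have hr0 : 0 ≤ r := localNorm_nonneg _ _ _
  have hrp : r ≤ p / (4 * √C) := by
    have h1 : localNorm f x v ≤ √C * p := h.upper.matNorm_le_sqrt_mul hC0.le v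
    calc r = 1 / (4 * C) * localNorm f x v := by
          rw [hr, localNorm_smul, abs_of_nonneg (by positivity)]
      _ ≤ 1 / (4 * C) * (√C * p) := mul_le_mul_of_nonneg_left h1 (by positivity)
      _ = 1 / (4 * (√C * √C)) * (√C * p) := by rw [hσC]
      _ = p / (4 * √C) := by field_simp
  -- Since the decrement is below 1, `p ≤ √C + 1/128 ≤ 2√C`.
  have hr2 : r ≤ 1 / 2 := by
    refine hrp.trans ?_
    rw [div_le_iff₀ (by positivity)]
    have := h.matNorm_approxStep_le (c := c) (η := η) hC hpd
    have := mul_le_mul_of_nonneg_left hdec.le (zero_le_one.trans hσ)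
    linarith
  -- The approximate slope is `-p²`; the gradient error costs at most `p/128 ≤ p²/4` because `p ≥
  -- 1/32`.
  have hlin : η * (c ⬝ᵥ v) + grad f x ⬝ᵥ v ≤ -(3 / 4 * p ^ 2) := by
    have h1 : (η • c + g) ⬝ᵥ v = -p ^ 2 := by
      rw [hp, matNorm_approxStep hQ, matNorm_inv_sq hQ, hv, approxStep, dotProduct_neg]
    have h2 := (abs_le.1 (abs_dotProduct_le hQ (g - grad f x) v)).1
    have h3 := mul_le_mul_of_nonneg_right (h.matNorm_inv_gradient_error_le hC hpd)
      (matNorm_nonneg Q v)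
    rw [add_dotProduct, smul_dotProduct, smul_eq_mul] at h1
    rw [sub_dotProduct] at h2
    nlinarith
  have hquad : (r / (1 - r)) ^ 2 ≤ p ^ 2 / (4 * C) := by
    have h1 : r / (1 - r) ≤ p / (2 * √C) := by
      calc r / (1 - r) ≤ 2 * r := by rw [div_le_iff₀ (by linarith)]; nlinarith
        _ ≤ 2 * (p / (4 * √C)) := by linarith
        _ = p / (2 * √C) := by field_simp; norm_num
    calc _ ≤ (p / (2 * √C)) ^ 2 := pow_le_pow_left₀ (div_nonneg hr0 (by linarith)) h1 2
      _ = p ^ 2 / (4 * C) := by rw [div_pow, mul_pow, Real.sq_sqrt hC0.le]; norm_num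
  have hsub := hf.sub_le hD hx (show r < 1 by linarith)
  have hpen := penalized_sub c f η x (x + (1 / (4 * C)) • v)
  rw [add_sub_cancel_left, dotProduct_smul, smul_eq_mul] at hpen
  rw [dotProduct_smul, smul_eq_mul] at hsub
  have hlin' := mul_le_mul_of_nonneg_left hlin (show 0 ≤ 1 / (4 * C) by positivity)
  refine ⟨hf.ball_subset x hx ?_, ?_⟩
  · rw [Set.mem_ofPred_eq, add_sub_cancel_left]
    exact hr2.trans_lt (by norm_num)
  · have e : 1 / (4 * C) * -(3 / 4 * p ^ 2) + p ^ 2 / (4 * C) / 2 = -(p ^ 2 / (16 * C)) := by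
      field_simp; norm_num
    have hdecr : 1 / (16384 * C) ≤ p ^ 2 / (16 * C) := by
      rw [div_le_div_iff₀ (by positivity) (by positivity)]
      nlinarith [mul_le_mul hlarge hlarge (by norm_num) (by linarith)]
    linarith

/-- Increasing the path parameter keeps a small decrement moderate. -/
lemma IsSelfConcordantBarrier.decrement_increase_le (hf : IsSelfConcordantBarrier D f)
    (hx : x ∈ D) (hsqrt : 1 / 6 ≤ √(complexity D f)) (hdec : decrement c f η x ≤ 5 / 128) :
    decrement c f ((1 + 1 / (8 * √(complexity D f))) * η) x ≤ 1 / 4 := by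
  set σ := √(complexity D f) with hσ
  have hpd := (hf.selfConcordant.posDef x hx).inv
  set u := 1 / (8 * σ) with hu
  have hu0 : 0 ≤ u := by positivity
  have hu1 : u ≤ 3 / 4 := by
    rw [hu, div_le_iff₀ (by linarith)]; linarith
  have huσ : u * σ = 1 / 8 := by rw [hu]; field_simp
  -- The first part contributes at most `(7/4)(5/128)`, the second at most `u√ϑ = 1/8`.
  have e : ((1 + u) * η) • c + grad f x = (1 + u) • (η • c + grad f x) + (-u) • grad f x := by
    module
  have h1 := mul_le_mul_of_nonneg_left (hf.matNorm_grad_le hx) hu0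
  have h2 := mul_le_mul_of_nonneg_left hdec (show 0 ≤ 1 + u by linarith)
  calc decrement c f ((1 + u) * η) x
      ≤ (1 + u) * decrement c f η x + u * matNorm (hess f x)⁻¹ (grad f x) := by
        rw [decrement, e]
        refine (matNorm_add_le hpd _ _).trans_eq ?_
        rw [matNorm_smul, matNorm_smul, abs_neg, abs_of_nonneg hu0, abs_of_nonneg (by linarith),
          decrement]
    _ ≤ 1 / 4 := by linarith

end ApproxStep

/-! ### The path-following method -/

section Run

variable {d : ℕ} {D : Set (Fin d → ℝ)} {f : (Fin d → ℝ) → ℝ} {c : Fin d → ℝ} {ε C η₀ : ℝ}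

/-- The invariant of the method after `k` rounds: `j` counts the updates of the path parameter
and `m` the moves since the last of them. -/
structure Invariant (D : Set (Fin d → ℝ)) (f : (Fin d → ℝ) → ℝ) (c : Fin d → ℝ) (ε C η₀ : ℝ)
    (k : ℕ) (s : IPMState d) (j m : ℕ) : Prop where
  rounds : (k : ℝ) ≤ j * (1366 * C + 1) + m
  eta_eq : s.eta = (1 + 1 / (8 * √(complexity D f))) ^ j * η₀
  eta_lt : ∀ i < j,
    ε * ((1 + 1 / (8 * √(complexity D f))) ^ i * η₀) < 2 * complexity D f
  mem : s.point ∈ D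
  gap : ∀ y ∈ D, penalized c f s.eta s.point - 1 / 12 + m / (16384 * C) ≤ penalized c f s.eta y

/-- The accumulated decrease cannot exceed the initial gap 1/12, and 16384/12 < 1366. -/
lemma Invariant.moves_le {k j m : ℕ} {s : IPMState d} (h : Invariant D f c ε C η₀ k s j m)
    (hC : 1 ≤ C) : (m : ℝ) ≤ 1366 * C := by
  have h1 : (m : ℝ) / (16384 * C) ≤ 1 / 12 := by linarith [h.gap _ h.mem]
  rw [div_le_iff₀ (by positivity)] at h1
  linarith

lemma Invariant.decrement_lt_one {k j m : ℕ} {s : IPMState d}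
    (h : Invariant D f c ε C η₀ k s j m) (hf : IsSelfConcordant D f) (hD : IsOpen D)
    (hC : 1 ≤ C) : decrement c f s.eta s.point < 1 := by
  refine hf.decrement_lt_one hD h.mem fun y hy => ?_
  have : 0 ≤ (m : ℝ) / (16384 * C) := by positivity
  linarith [h.gap y hy]

/-- One round either preserves the invariant or halts at a nearly optimal point. -/
lemma Invariant.step {k j m : ℕ} {s : IPMState d} {g : Fin d → ℝ}
    {Q : Matrix (Fin d) (Fin d) ℝ} (h : Invariant D f c ε C η₀ k s j m)
    (hf : IsSelfConcordantBarrier D f) (hd : 0 < d) (hD : IsOpen D) (hconv : Convex ℝ D)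
    (hC : 1 ≤ C) (hs : s.halted = false) (happ : IsApprox f C s.point g Q) :
    ((ipmStep c (complexity D f) ε C g Q s).halted = false ∧
      ∃ j' m', Invariant D f c ε C η₀ (k + 1) (ipmStep c (complexity D f) ε C g Q s) j' m') ∨
    ((ipmStep c (complexity D f) ε C g Q s).halted = true ∧
      (ipmStep c (complexity D f) ε C g Q s).point = s.point ∧
      2 * complexity D f ≤ ε * s.eta ∧ decrement c f s.eta s.point ≤ 5 / 128) := by
  have hsc := hf.selfConcordant
  have hpd := hsc.posDef _ h.mem
  have hstep : ipmStep c (complexity D f) ε C g Q s =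
      if 1 / 32 ≤ matNorm Q (approxStep c s.eta g Q) then
        { s with point := s.point + (1 / (4 * C)) • approxStep c s.eta g Q }
      else if 2 * complexity D f ≤ ε * s.eta then { s with halted := true }
      else { s with eta := (1 + 1 / (8 * √(complexity D f))) * s.eta } := by
    rw [ipmStep, hs]; rfl
  rw [hstep]
  have hround := h.rounds
  have hm := h.moves_le hC
  by_cases h1 : 1 / 32 ≤ matNorm Q (approxStep c s.eta g Q)
  · rw [if_pos h1]
    obtain ⟨hmem, hdecr⟩ := happ.step hsc hD hC h.mem (h.decrement_lt_one hsc hD hC) h1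
    refine Or.inl ⟨hs, j, m + 1, ?_, h.eta_eq, h.eta_lt, hmem, fun y hy => ?_⟩
    · push_cast; linarith
    · have := h.gap y hy
      dsimp only
      push_cast
      rw [add_div]
      linarith
  rw [if_neg h1]
  have hdec : decrement c f s.eta s.point ≤ 5 / 128 := by
    linarith [happ.decrement_le (c := c) (η := s.eta) hC hpd]
  by_cases h2 : 2 * complexity D f ≤ ε * s.eta
  · rw [if_pos h2]
    exact Or.inr ⟨rfl, rfl, h2, hdec⟩
  · rw [if_neg h2]
    -- The finished phase is charged to `j`, and the gap is established afresh from the new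
    -- decrement.
    refine Or.inl ⟨hs, j + 1, 0, ?_, ?_, fun i hi => ?_, h.mem, fun y hy => ?_⟩
    · push_cast; linarith
    · dsimp only
      rw [h.eta_eq, pow_succ]; ring
    · rcases Nat.lt_succ_iff_lt_or_eq.1 hi with hi | rfl
      · exact h.eta_lt i hi
      · rw [← h.eta_eq]; exact not_le.1 h2
    · rw [Nat.cast_zero, zero_div, add_zero]
      exact hsc.penalized_ge hD hconv h.mem hy
        (hf.decrement_increase_le h.mem (hf.sqrt_complexity_ge hd hD hconv h.mem) hdec)

/-- The number of updates of the path parameter is logarithmic. -/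
lemma Invariant.updates_le {k j m : ℕ} {s : IPMState d} (h : Invariant D f c ε C η₀ k s j m)
    (hη₀ : 0 < η₀) (hε : 0 < ε) (hsqrt : 1 / 6 ≤ √(complexity D f)) :
    (j : ℝ) ≤ 1 + 28 * √(complexity D f) * Real.log (2 + complexity D f / (η₀ * ε)) := by
  set σ := √(complexity D f) with hσ
  have hϑ : 0 < complexity D f := Real.sqrt_pos.1 (by linarith)
  set a := complexity D f / (η₀ * ε) with ha
  have ha0 : 0 < a := by positivity
  have hL : 0 ≤ Real.log (2 + a) := Real.log_nonneg (by linarith)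
  rcases j with _ | i
  · simp only [Nat.cast_zero]; positivity
  set u := 1 / (8 * σ) with hu
  have hu0 : 0 < u := by positivity
  -- The last update occurred at a parameter that had failed the stopping test, so the power is
  -- below `2a`.
  have hlt : (1 + u) ^ i ≤ (2 + a) ^ 2 := by
    have h1 := h.eta_lt i i.lt_succ_self
    have h2 : (1 + u) ^ i * (η₀ * ε) < 2 * a * (η₀ * ε) := by
      have e : 2 * a * (η₀ * ε) = 2 * complexity D f := by
        rw [ha, mul_assoc, div_mul_cancel₀ _ (by positivity)]
      rw [e]
      linarith
    have h3 := lt_of_mul_lt_mul_right h2 (by positivity)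
    nlinarith
  have hlog := Real.log_le_log (by positivity) hlt
  rw [Real.log_pow, Real.log_pow] at hlog
  -- `log (1 + u) ≥ 1 - 1/(1 + u) = 1/(8σ + 1)`, and `1 ≤ 6σ`.
  have hlogu : 1 / (14 * σ) ≤ Real.log (1 + u) := by
    refine le_trans ?_ (Real.one_sub_inv_le_log_of_pos (by linarith))
    have e : 1 - (1 + u)⁻¹ = 1 / (8 * σ + 1) := by
      rw [hu]; field_simp; ring
    rw [e]
    exact one_div_le_one_div_of_le (by linarith) (by linarith)
  have h1 := (mul_le_mul_of_nonneg_left hlogu (Nat.cast_nonneg i)).trans hlog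
  rw [mul_one_div, div_le_iff₀ (by linarith)] at h1
  push_cast at h1 ⊢
  linarith

/-- The bound on the number of rounds in terms of the number of updates. -/
lemma rounds_bound {N j σ L C : ℝ} (hC : 1 ≤ C) (hσ : 1 / 6 ≤ σ) (hL : 1 / 2 ≤ L)
    (hj : j ≤ 1 + 28 * σ * L) (hN : N ≤ (j + 1) * (1366 * C + 1) + 1) :
    N ≤ 75000 * C ^ 2 * σ * L := by
  -- This absorbs the additive constants: `2 ≤ 24 σL` gives 52 = 24 + 28.
  have hσL : 1 / 12 ≤ σ * L := by nlinarith
  have h1 : j + 1 ≤ 52 * (σ * L) := by linarith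
  have h2 : (j + 1) * (1366 * C + 1) ≤ 52 * (σ * L) * (1367 * C) :=
    mul_le_mul h1 (by linarith) (by linarith) (by positivity)
  have h3 : σ * L ≤ σ * L * C := le_mul_of_one_le_right (by linarith) hC
  have h4 : σ * L * C ≤ σ * L * C ^ 2 :=
    mul_le_mul_of_nonneg_left (le_self_pow₀ hC two_ne_zero) (by linarith)
  linarith

lemma log_two_add_le {a ε : ℝ} (ha : 0 ≤ a) (hε : 0 < ε) (hε2 : ε ≤ 1 / 2)
    (h : a ≤ 1 / ε ^ 2) : Real.log (2 + a) ≤ 4 * Real.log (1 / ε) := by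
  have hinv : 2 ≤ 1 / ε := by rw [le_div_iff₀ hε]; linarith
  have e : 4 * Real.log (1 / ε) = Real.log ((1 / ε) ^ 4) := by rw [Real.log_pow]; norm_num
  rw [e]
  refine Real.log_le_log (by linarith) ?_
  rw [← _root_.one_div_pow] at h
  nlinarith [mul_le_mul hinv hinv (by norm_num) (by linarith)]

end Run

end ApproxIPM
-- Termination, accuracy and the round count
open ApproxIPM
theorem theorem6p1 :
    ∃ K : ℝ, 0 < K ∧
      ∀ (d : ℕ) (_ : 0 < d)
        -- the problem: minimize `cᵀx` over `D`
        (D : Set (Fin d → ℝ)) (_ : IsOpen D) (_ : Convex ℝ D) (_ : Bornology.IsBounded D)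
        (c : Fin d → ℝ)
        -- the barrier
        (f : (Fin d → ℝ) → ℝ) (_ : ApproxIPM.IsSelfConcordantBarrier D f)
        -- the initial point: the Newton step of `f_η₀` at `z₀` is small in the local norm
        (η₀ : ℝ) (_ : 0 < η₀) (z₀ : Fin d → ℝ) (_ : z₀ ∈ D)
        (_ : ApproxIPM.localNorm (ApproxIPM.penalized c f η₀) z₀
              (ApproxIPM.newtonStep (ApproxIPM.penalized c f η₀) z₀) ≤ 1 / 4)
        -- the target accuracy, and the quality of the approximate Hessians
        (ε : ℝ) (_ : 0 < ε) (C : ℝ) (_ : 1 ≤ C)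
        -- arbitrary approximate gradients and Hessians of the prescribed quality
        (gt : ℕ → (Fin d → ℝ) → (Fin d → ℝ))
        (Ht : ℕ → (Fin d → ℝ) → Matrix (Fin d) (Fin d) ℝ)
        (_ : ∀ k, ∀ x ∈ D,
          ApproxIPM.matNorm (ApproxIPM.hess f x)⁻¹ (gt k x - ApproxIPM.grad f x)
            ≤ 1 / (128 * √C))
        (_ : ∀ k, ∀ x ∈ D,
          ApproxIPM.LoewnerLE (Ht k x) (ApproxIPM.hess f x) ∧
            ApproxIPM.LoewnerLE (ApproxIPM.hess f x) (C • Ht k x)),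
      -- the method makes exactly `N` rounds, all of them at points of `D`
      ∃ N : ℕ,
        (∀ k < N,
          (ApproxIPM.ipmRun c (ApproxIPM.complexity D f) ε C gt Ht η₀ z₀ k).halted = false ∧
          (ApproxIPM.ipmRun c (ApproxIPM.complexity D f) ε C gt Ht η₀ z₀ k).point ∈ D) ∧
        (ApproxIPM.ipmRun c (ApproxIPM.complexity D f) ε C gt Ht η₀ z₀ N).halted = true ∧
        -- the returned point is feasible and `ε`-optimal
        (ApproxIPM.ipmRun c (ApproxIPM.complexity D f) ε C gt Ht η₀ z₀ N).point ∈ D ∧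
        c ⬝ᵥ (ApproxIPM.ipmRun c (ApproxIPM.complexity D f) ε C gt Ht η₀ z₀ N).point
          ≤ sInf ((fun x => c ⬝ᵥ x) '' D) + ε ∧
        -- the number of approximate gradients and Hessians
        (N : ℝ) ≤ K * C ^ 2 * √(ApproxIPM.complexity D f)
            * Real.log (2 + ApproxIPM.complexity D f / (η₀ * ε)) ∧
        (ε ≤ 1 / 2 → ApproxIPM.complexity D f / η₀ ≤ 1 / ε →
          (N : ℝ) ≤ K * C ^ 2 * √(ApproxIPM.complexity D f) * Real.log (1 / ε)) := by

  -- 75000 from `rounds_bound`, times the 4 from `log_two_add_le`.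
  refine ⟨300000, by norm_num, ?_⟩
  intro d hd D hD hconv hbdd c f hf η₀ hη₀ z₀ hz₀ hinit ε hε C hC gt Ht hgt hHt
  have hsc := hf.selfConcordant
  have hsqrt := hf.sqrt_complexity_ge hd hD hconv hz₀
  have hϑ : 0 < complexity D f := Real.sqrt_pos.1 (by linarith)
  rw [hsc.localNorm_newtonStep_penalized hD hz₀] at hinit
  set run := ipmRun c (complexity D f) ε C gt Ht η₀ z₀ with hrun
  have happ : ∀ k, ∀ x ∈ D, IsApprox f C x (gt k x) (Ht k x) := fun k x hx =>
    ⟨hgt k x hx, (hHt k x hx).1, (hHt k x hx).2⟩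
  have hinv : ∀ k, (∀ i ≤ k, (run i).halted = false) →
      ∃ j m, Invariant D f c ε C η₀ k (run k) j m := by
    intro k
    induction k with
    | zero =>
      refine fun _ => ⟨0, 0, by simp, by simp [hrun, ipmRun], by simp, hz₀, fun y hy => ?_⟩
      rw [Nat.cast_zero, zero_div, add_zero]
      exact hsc.penalized_ge hD hconv hz₀ hy hinit
    | succ k ih =>
      intro hk
      obtain ⟨j, m, h⟩ := ih fun i hi => hk i (hi.trans k.le_succ)
      rcases h.step hf hd hD hconv hC (hk k k.le_succ) (happ k _ h.mem) with h' | h'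
      · exact h'.2
      · exact absurd (h'.1.symm.trans (hk (k + 1) le_rfl)) (by simp)
  set L := Real.log (2 + complexity D f / (η₀ * ε)) with hL
  have hL2 : 1 / 2 ≤ L := by
    have h1 : Real.log 2 ≤ L :=
      Real.log_le_log two_pos (le_add_of_nonneg_right (by positivity))
    linarith [Real.log_two_gt_d9]
  -- The bound is on `k + 1`, so it also counts the round that halts. Being independent of `k`, it
  -- forces termination.
  have hbound : ∀ k, (∀ i ≤ k, (run i).halted = false) →
      ((k + 1 : ℕ) : ℝ) ≤ 75000 * C ^ 2 * √(complexity D f) * L := by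
    intro k hk
    obtain ⟨j, m, h⟩ := hinv k hk
    refine rounds_bound hC hsqrt hL2 (h.updates_le hη₀ hε hsqrt) ?_
    push_cast
    linarith [h.rounds, h.moves_le hC]
  have hhalt : ∃ N, (run N).halted = true := by
    by_contra! hne
    obtain ⟨n, hn⟩ := exists_nat_gt (75000 * C ^ 2 * √(complexity D f) * L)
    have := hbound n fun i _ => by simpa using hne i
    push_cast at this
    linarith
  classical
  obtain ⟨N, hN, hmin⟩ : ∃ N, (run N).halted = true ∧ ∀ k < N, (run k).halted = false :=
    ⟨Nat.find hhalt, Nat.find_spec hhalt, fun k hk => by simpa using Nat.find_min hhalt hk⟩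
  -- The initial state is not halted, so the halting round starts from state `n`, where the
  -- invariant holds.
  rcases N with _ | n
  · exact absurd hN (by simp [hrun, ipmRun])
  have hlast : ∀ i ≤ n, (run i).halted = false := fun i hi => hmin i (Nat.lt_succ_of_le hi)
  obtain ⟨j, m, h⟩ := hinv n hlast
  have hNle := hbound n hlast
  rcases h.step hf hd hD hconv hC (hlast n le_rfl) (happ n _ h.mem) with h' | ⟨-, hpt, hη, hdec⟩
  · exact absurd (h'.1.symm.trans hN) (by simp)
  have hpt' : (run (n + 1)).point = (run n).point := hpt
  have hηpos : 0 < (run n).eta := by rw [h.eta_eq]; positivity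
  have hfac : 0 ≤ C ^ 2 * √(complexity D f) := by positivity
  refine ⟨n + 1, fun k hk => ⟨hmin k hk, ?_⟩, hN, ?_, ?_, ?_, fun hε2 hratio => ?_⟩
  · obtain ⟨_, _, hk'⟩ := hinv k fun i hi => hmin i (hi.trans_lt hk)
    exact hk'.mem
  · rw [hpt']; exact h.mem
  · rw [hpt', ← sub_le_iff_le_add]
    refine le_csInf ⟨_, z₀, hz₀, rfl⟩ ?_
    rintro _ ⟨y, hy, rfl⟩
    rw [sub_le_iff_le_add]
    exact hf.dotProduct_le hd hD hconv hbdd hηpos hη h.mem hy hdec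
  · have := mul_nonneg hfac (show 0 ≤ L by linarith)
    linarith
  · have ha : complexity D f / (η₀ * ε) ≤ 1 / ε ^ 2 := by
      rw [← div_div, sq, ← div_div]
      exact div_le_div_of_nonneg_right hratio hε.le
    have := mul_le_mul_of_nonneg_left (log_two_add_le (by positivity) hε hε2 ha) hfac
    linarith
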